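/- Let $G$ be a finitely generated group with infinitely many ends, i.e. such that the Cayley graph of $G$ with respect to a finite generating set has infinitely many ends (this does not depend on the finite generating set), and let $1<p<\infty$ be real. Let $L^p(G)$ be the space of functions $f\colon G\to\mathbb{R}$ with $\sum_{g\in G}|f(g)|^p<\infty$, with the norm $\|f\|_p=(\sum_{g\in G}|f(g)|^p)^{1/p}$ and the right $G$-action by right translations $f_x(g)=f(gx^{-1})$. Let $Z^1$ be the space of $1$-cocycles, i.e. of maps $b\colon G\to L^p(G)$ with $b(xy)=b(x)_y+b(y)$ for all $x,y\in G$, with the topology of pointwise convergence on $G$ (with respect to $\|\cdot\|_p$), and let $B^1\subseteq Z^1$ be the subspace of $1$-coboundaries, i.e. of the maps $x\mapsto f_x-f$ with $f\in L^p(G)$. Then the first reduced $L^p$-cohomology space $\overline{H}^1_{(p)}(G)=Z^1/\overline{B^1}$, where the closure is taken in $Z^1$, is nonzero. -/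

import Mathlib

open scoped ENNReal

noncomputable section

/-- `L^p(G)`: the real-valued functions on `G` with `∑ |f g| ^ p < ∞`, with the `p`-norm. -/
abbrev GroupLp (G : Type*) (p : ℝ≥0∞) : Type _ := lp (fun _ : G => ℝ) p

/-- `L^p(G)` (for `1 ≤ p`) is stable under the right translations `f ↦ f_x`. -/
theorem memℓp_rightTranslate {G : Type*} [Group G] {p : ℝ≥0∞} [hp : Fact (1 ≤ p)] (x : G)
    (f : GroupLp G p) : Memℓp (fun g : G => f (g * x⁻¹)) p := by
  have hf := lp.memℓp f
  rcases eq_or_ne p ∞ with rfl | hpt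
  · rw [memℓp_infty_iff] at hf ⊢
    refine hf.mono ?_
    rintro _ ⟨g, rfl⟩
    exact ⟨g * x⁻¹, rfl⟩
  · have h0 : 0 < p.toReal :=
      ENNReal.toReal_pos (zero_lt_one.trans_le hp.out).ne' hpt
    rw [memℓp_gen_iff h0] at hf ⊢
    exact (Equiv.mulRight x⁻¹).summable_iff.mpr hf

/-- The right translation `f_x (g) = f (g x⁻¹)` as a linear map of `L^p(G)`. -/
def rightTranslate {G : Type*} [Group G] {p : ℝ≥0∞} [Fact (1 ≤ p)] (x : G) :
    GroupLp G p →ₗ[ℝ] GroupLp G p where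
  toFun f := ⟨fun g => f (g * x⁻¹), memℓp_rightTranslate x f⟩
  map_add' _ _ := rfl
  map_smul' _ _ := rfl

@[simp]
theorem rightTranslate_apply {G : Type*} [Group G] {p : ℝ≥0∞} [Fact (1 ≤ p)] (x : G)
    (f : GroupLp G p) (g : G) : rightTranslate x f g = f (g * x⁻¹) := rfl

/-- Right translations form a right action: `(f_x)_y = f_{xy}`. -/
theorem rightTranslate_mul {G : Type*} [Group G] {p : ℝ≥0∞} [Fact (1 ≤ p)] (x y : G)
    (f : GroupLp G p) : rightTranslate (x * y) f = rightTranslate y (rightTranslate x f) := by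
  ext g
  simp [mul_assoc]

/-- The coboundary `δ₀ : L^p(G) → C¹(G, L^p(G))`, `(δ₀ f)(x) = f * (x - 1) = f_x - f`. -/
def coboundaryZero (G : Type*) [Group G] (p : ℝ≥0∞) [Fact (1 ≤ p)] :
    GroupLp G p →ₗ[ℝ] (G → GroupLp G p) where
  toFun f x := rightTranslate x f - f
  map_add' f₁ f₂ := by
    funext x
    simp only [map_add, Pi.add_apply]
    abel
  map_smul' c f := by
    funext x
    simp only [map_smul, Pi.smul_apply, RingHom.id_apply, smul_sub]

/-- The coboundary `δ₁ : C¹(G, L^p(G)) → C²(G, L^p(G))` for the right `G`-module `L^p(G)`: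
`(δ₁ b)(x, y) = b(x) · y - b(x y) + b(y)`. -/
def coboundaryOne (G : Type*) [Group G] (p : ℝ≥0∞) [Fact (1 ≤ p)] :
    (G → GroupLp G p) →ₗ[ℝ] (G × G → GroupLp G p) where
  toFun b z := rightTranslate z.2 (b z.1) - b (z.1 * z.2) + b z.2
  map_add' b₁ b₂ := by
    funext z
    simp only [map_add, Pi.add_apply]
    abel
  map_smul' c b := by
    funext z
    simp only [map_smul, Pi.smul_apply, RingHom.id_apply, smul_sub, smul_add]

/-- `δ₁ δ₀ = 0`. -/
theorem coboundaryOne_coboundaryZero (G : Type*) [Group G] (p : ℝ≥0∞) [Fact (1 ≤ p)]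
    (f : GroupLp G p) : coboundaryOne G p (coboundaryZero G p f) = 0 := by
  funext z
  simp only [coboundaryOne, coboundaryZero, LinearMap.coe_mk, AddHom.coe_mk, map_sub,
    rightTranslate_mul, Pi.zero_apply]
  abel

/-- The space of `1`-cocycles `ker δ₁`, a subspace of `C¹(G, L^p(G)) = (G → L^p(G))`; it carries
the topology of pointwise convergence in the `p`-norm. -/
abbrev oneCocycles (G : Type*) [Group G] (p : ℝ≥0∞) [Fact (1 ≤ p)] :
    Submodule ℝ (G → GroupLp G p) :=
  LinearMap.ker (coboundaryOne G p)

/-- The image of `δ₀`, as a subspace of `ker δ₁`. -/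
def oneCoboundaries (G : Type*) [Group G] (p : ℝ≥0∞) [Fact (1 ≤ p)] :
    Submodule ℝ (oneCocycles G p) :=
  (LinearMap.range (coboundaryZero G p)).comap (oneCocycles G p).subtype

/-- The first reduced `L^p`-cohomology space of `G`: the quotient of `ker δ₁` by the closure of
`im δ₀` in `ker δ₁`. -/
abbrev ReducedLpCohomologyOne (G : Type*) [Group G] (p : ℝ≥0∞) [Fact (1 ≤ p)] : Type _ :=
  oneCocycles G p ⧸ (oneCoboundaries G p).topologicalClosure

/-- A group has infinitely many ends if its Cayley graph with respect to some finite generating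
set has infinitely many ends (the number of ends is the same for all finite generating sets). -/
def HasInfinitelyManyEnds (G : Type*) [Group G] : Prop :=
  ∃ S : Finset G, Subgroup.closure (S : Set G) = ⊤ ∧
    Infinite (SimpleGraph.mulCayley (S : Set G)).end

end

open scoped Pointwise

/-!
Infinitely many ends yield a ball `F ^ n` of the Cayley graph whose complement splits into three
infinite parts `D 0`, `D 1`, `D 2` with no edges between them (a tripod,
`HasInfinitelyManyEnds.exists_isTripod`). The indicator function `f` of `D 0` has finitely supported
differences `f_x - f`, so it defines a cocycle with values in `L^p(G)`. It is not a coboundary: two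
functions with the same differences differ by a constant, and since `D 0` and `D 1` are both
infinite, no constant `c` makes `f - c` an element of `L^p(G)`.

That this cocycle is not even a limit of coboundaries follows because `B^1` is closed in a strong
sense: the norm of `h ∈ L^p(G)` is bounded by a multiple of finitely many of the norms `‖h_t - h‖`
(`exists_norm_le_differences`), so that the map `h ↦ (h_t - h)_t` has closed range. The bound
expresses the non-amenability of `G`, and is proved directly from the tripod. A finite set `A`
contains the centres of a family of disjoint balls whose number is proportional to the size of `A`.
Each of these balls branches its complement into three infinite parts; as in a tree,
the complement of `N` of them has at least `N` disjoint infinite parts without edges between them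
(`IsTripod.exists_sides`, by removing extremal balls one at a time). Each part contains points at
every large distance from `A`, so a thickening of `A` of fixed width has at least `2 |A|` elements
(`IsTripod.exists_two_mul_card_le`). Hall's marriage theorem converts this into two injections
`G → G` with disjoint ranges and bounded displacement. The pullbacks of `h` along these injections
have `p`-th powers of norms adding up to at most `‖h‖ ^ p`, while each of them differs from `h` by
at most a multiple of the differences of `h`; this forces the bound.
-/

/-! ### Sides of a set in a Cayley graph -/

/-- A finite symmetric generating set containing the identity. -/
structure IsSymmGen {G : Type*} [Group G] (F : Finset G) : Prop where
  one_mem : 1 ∈ F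
  inv_mem : ∀ s ∈ F, s⁻¹ ∈ F
  closure_eq : Subgroup.closure (F : Set G) = ⊤

/-- `E` is a union of connected components of the complement of `U` in the Cayley graph of `G`
with respect to `F`. -/
structure IsSide {G : Type*} [Group G] (F : Finset G) (U E : Set G) : Prop where
  notMem : ∀ x ∈ E, x ∉ U
  mul_mem : ∀ x ∈ E, ∀ s ∈ F, x * s ∉ U → x * s ∈ E

/-- Removing the ball `F ^ n` from the Cayley graph leaves a complement that is the disjoint union
of three infinite sides. -/
structure IsTripod {G : Type*} [Group G] (F : Finset G) (n : ℕ) (D : Fin 3 → Set G) : Prop where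
  side : ∀ a, IsSide F ((F : Set G) ^ n) (D a)
  infinite : ∀ a, (D a).Infinite
  eq_of_mem : ∀ a b x, x ∈ D a → x ∈ D b → a = b
  cover : ∀ x, x ∉ (F : Set G) ^ n → ∃ a, x ∈ D a

section Sides

variable {G : Type*} [Group G] {F : Finset G}

theorem IsSymmGen.pow_mono (hF : IsSymmGen F) {m n : ℕ} (h : m ≤ n) :
    (F : Set G) ^ m ⊆ (F : Set G) ^ n :=
  Set.pow_subset_pow_right (by exact_mod_cast hF.one_mem) h

theorem IsSymmGen.one_mem_pow (hF : IsSymmGen F) (n : ℕ) : (1 : G) ∈ (F : Set G) ^ n :=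
  hF.pow_mono (Nat.zero_le n) (by simp)

theorem IsSymmGen.inv_mem_pow (hF : IsSymmGen F) (n : ℕ) {x : G} (hx : x ∈ (F : Set G) ^ n) :
    x⁻¹ ∈ (F : Set G) ^ n := by
  have h : (F : Set G)⁻¹ = F := by
    ext s
    exact ⟨fun hs => inv_inv s ▸ hF.inv_mem _ hs,
      fun hs => by simpa using hF.inv_mem _ (by simpa using hs)⟩
  rw [← Set.mem_inv, ← inv_pow, h]
  exact hx

theorem IsSymmGen.mem_of_mul_mem (hF : IsSymmGen F) {X : Set G} {x : G} (hx : x ∈ X)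
    (h : ∀ y ∈ X, ∀ s ∈ F, y * s ∈ X) (y : G) : y ∈ X := by
  have key : ∀ z ∈ Subgroup.closure (F : Set G), ∀ w ∈ X, w * z ∈ X := by
    intro z hz
    induction hz using Subgroup.closure_induction'' with
    | mem s hs => exact fun w hw => h w hw s hs
    | inv_mem s hs => exact fun w hw => h w hw _ (hF.inv_mem s hs)
    | one => simp
    | mul a b _ _ ha hb => exact fun w hw => by rw [← mul_assoc]; exact hb _ (ha _ hw)
  have := key (x⁻¹ * y) (by rw [hF.closure_eq]; trivial) x hx
  simpa using this

theorem IsSymmGen.exists_mem_pow (hF : IsSymmGen F) (x : G) : ∃ n, x ∈ (F : Set G) ^ n := by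
  refine hF.mem_of_mul_mem (X := {x | ∃ n, x ∈ (F : Set G) ^ n}) (x := 1) ⟨0, by simp⟩ ?_ x
  rintro y ⟨n, hn⟩ s hs
  exact ⟨n + 1, by rw [pow_succ]; exact Set.mul_mem_mul hn hs⟩

theorem IsSide.smul {U E : Set G} (h : IsSide F U E) (g : G) : IsSide F (g • U) (g • E) where
  notMem x hx := by
    rw [Set.mem_smul_set_iff_inv_smul_mem] at hx ⊢
    exact h.notMem _ hx
  mul_mem x hx s hs hxs := by
    rw [Set.mem_smul_set_iff_inv_smul_mem, smul_eq_mul] at hx hxs ⊢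
    rw [← mul_assoc] at hxs ⊢
    exact h.mul_mem _ hx s hs hxs

/-- A ball disjoint from `U` whose centre lies in a side of `U` is contained in that side. -/
theorem IsSide.ball_subset (hF : IsSymmGen F) {U E : Set G} (h : IsSide F U E) {g : G}
    (hg : g ∈ E) (n : ℕ) (hU : ∀ x ∈ g • (F : Set G) ^ n, x ∉ U) :
    ∀ x ∈ g • (F : Set G) ^ n, x ∈ E := by
  induction n with
  | zero =>
    rintro _ ⟨y, hy, rfl⟩
    rw [pow_zero, Set.mem_one] at hy
    simpa [hy] using hg
  | succ n ih =>
    rintro _ ⟨y, hy, rfl⟩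
    have hxU := hU _ ⟨y, hy, rfl⟩
    rw [pow_succ] at hy
    obtain ⟨w, hw, s, hs, rfl⟩ := hy
    have hw' := ih (fun x hx => hU x (Set.smul_set_mono (hF.pow_mono n.le_succ) hx)) _ ⟨w, hw, rfl⟩
    simp only [smul_eq_mul, ← mul_assoc] at hw' hxU ⊢
    exact h.mul_mem _ hw' s hs hxU

/-- A side of `U` that meets a ball disjoint from `U` contains the centre of that ball. -/
theorem IsSide.centre_mem (hF : IsSymmGen F) {U E : Set G} (h : IsSide F U E) {g : G} (n : ℕ)
    (hU : ∀ x ∈ g • (F : Set G) ^ n, x ∉ U) {x : G} (hx : x ∈ g • (F : Set G) ^ n)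
    (hxE : x ∈ E) : g ∈ E := by
  induction n generalizing x with
  | zero =>
    obtain ⟨y, hy, rfl⟩ := hx
    rw [pow_zero, Set.mem_one] at hy
    simpa [hy] using hxE
  | succ n ih =>
    obtain ⟨y, hy, rfl⟩ := hx
    rw [pow_succ] at hy
    obtain ⟨w, hw, s, hs, rfl⟩ := hy
    have hU' : ∀ x ∈ g • (F : Set G) ^ n, x ∉ U :=
      fun x hx => hU x (Set.smul_set_mono (hF.pow_mono n.le_succ) hx)
    have hw' : g * w ∈ g • (F : Set G) ^ n := ⟨w, hw, rfl⟩
    refine ih hU' hw' ?_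
    have h1 : g * (w * s) * s⁻¹ = g * w := by group
    have h2 := h.mul_mem _ hxE _ (hF.inv_mem s hs)
    simp only [smul_eq_mul, h1] at h2
    exact h2 (hU' _ hw')

/-- A nonempty set closed under right multiplication by `F` is everything; hence a side of `W`
meeting a side `D` of `K` has to reach `K`, provided that `W` does not get in the way. -/
theorem IsSide.exists_mem_inter (hF : IsSymmGen F) {K D W E : Set G} (hD : IsSide F K D)
    (hE : IsSide F W E) (hK : K.Nonempty) (hWD : ∀ x ∈ D, x ∉ W) (hWK : ∀ x ∈ K, x ∉ W) {x : G}
    (hxD : x ∈ D) (hxE : x ∈ E) : ∃ k ∈ K, k ∈ E := by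
  by_contra! hcon
  obtain ⟨k, hk⟩ := hK
  refine hD.notMem k (hF.mem_of_mul_mem (X := D ∩ E) ⟨hxD, hxE⟩ ?_ k).1 hk
  rintro y ⟨hyD, hyE⟩ s hs
  by_cases hys : y * s ∈ K
  · exact absurd (hE.mul_mem y hyE s hs (hWK _ hys)) (hcon _ hys)
  · have := hD.mul_mem y hyD s hs hys
    exact ⟨this, hE.mul_mem y hyE s hs (hWD _ this)⟩

/-! ### Translates of a tripod -/

/-- Among pairwise disjoint translates of the ball of a tripod there is an extremal one: a single
one of its three sides contains the centres of all the others. -/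
theorem IsTripod.exists_leaf (hF : IsSymmGen F) {n : ℕ} {D : Fin 3 → Set G} (hD : IsTripod F n D)
    (S : Finset G) (hS : S.Nonempty)
    (hdisj : ∀ g ∈ S, ∀ h ∈ S, g ≠ h → Disjoint (g • (F : Set G) ^ n) (h • (F : Set G) ^ n)) :
    ∃ g ∈ S, ∃ a, ∀ h ∈ S, h ≠ g → h ∈ g • D a := by
  classical
  have hcentre : ∀ g : G, g ∈ g • (F : Set G) ^ n := fun g => ⟨1, hF.one_mem_pow n, by simp⟩
  have hball : ∀ g ∈ S, ∀ h ∈ S, g ≠ h → ∃ a, h ∈ g • D a := by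
    intro g hg h hh hne
    have h1 : h ∉ g • (F : Set G) ^ n :=
      fun h1 => Set.disjoint_left.1 (hdisj g hg h hh hne) h1 (hcentre h)
    rw [Set.mem_smul_set_iff_inv_smul_mem] at h1
    obtain ⟨a, ha⟩ := hD.cover _ h1
    exact ⟨a, Set.mem_smul_set_iff_inv_smul_mem.2 ha⟩
  obtain ⟨⟨g, a⟩, hga, hmax⟩ := Finset.exists_max_image (S ×ˢ (Finset.univ : Finset (Fin 3)))
    (fun q => (S.filter (fun h => h ∈ q.1 • D q.2)).card)
    (hS.product Finset.univ_nonempty)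
  have hg : g ∈ S := (Finset.mem_product.1 hga).1
  refine ⟨g, hg, a, ?_⟩
  by_contra! hcon
  obtain ⟨h, hh, hne, hha⟩ := hcon
  -- The side of `h` containing `g` also contains the chosen side of `g`, hence more centres.
  obtain ⟨c, hc⟩ := hball h hh g hg hne
  obtain ⟨b, hb⟩ := hball g hg h hh hne.symm
  have hgK := ((hD.side c).smul h).ball_subset hF hc n
    (fun x hx hx' => Set.disjoint_left.1 (hdisj g hg h hh hne.symm) hx hx')
  have hhK := ((hD.side b).smul g).ball_subset hF hb n
    (fun x hx hx' => Set.disjoint_left.1 (hdisj h hh g hg hne) hx hx')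
  have hne' : ∀ x ∈ g • D a, x ∉ h • (F : Set G) ^ n := by
    intro x hx hx'
    have := hhK x hx'
    rw [Set.mem_smul_set_iff_inv_smul_mem] at hx this
    have hab := hD.eq_of_mem _ _ _ hx this
    exact hha (hab ▸ hb)
  have hsub : ∀ x ∈ g • D a, x ∈ h • D c := by
    intro x hx
    have h1 := hne' x hx
    rw [Set.mem_smul_set_iff_inv_smul_mem] at h1
    obtain ⟨c', hc'⟩ := hD.cover _ h1
    rw [← Set.mem_smul_set_iff_inv_smul_mem] at hc'
    obtain ⟨k, hk, hkE⟩ := ((hD.side a).smul g).exists_mem_inter hF ((hD.side c').smul h)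
      ⟨g, hcentre g⟩ hne'
      (fun x hx hx' => Set.disjoint_left.1 (hdisj g hg h hh hne.symm) hx hx') hx hc'
    have h2 := hgK k hk
    rw [Set.mem_smul_set_iff_inv_smul_mem] at hkE h2
    rw [hD.eq_of_mem _ _ _ h2 hkE]
    exact hc'
  have hlt : (S.filter (fun x => x ∈ g • D a)).card < (S.filter (fun x => x ∈ h • D c)).card := by
    apply Finset.card_lt_card
    refine ⟨fun x hx => ?_, fun hss => ?_⟩
    · rw [Finset.mem_filter] at hx ⊢
      exact ⟨hx.1, hsub x hx.2⟩
    · have h1 := (Finset.mem_filter.1 (hss (Finset.mem_filter.2 ⟨hg, hc⟩))).2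
      exact ((hD.side a).smul g).notMem g h1 (hcentre g)
  exact absurd (hmax (h, c) (Finset.mem_product.2 ⟨hh, Finset.mem_univ c⟩)) (not_le.2 hlt)

/-- The complement of `N` pairwise disjoint translates of the ball of a tripod has at least `N`
pairwise disjoint infinite sides. Adding an extremal translate destroys at most one of the old
sides, the one containing it, and creates two new ones. -/
theorem IsTripod.exists_sides (hF : IsSymmGen F) {n : ℕ} {D : Fin 3 → Set G}
    (hD : IsTripod F n D) (S : Finset G)
    (hdisj : ∀ g ∈ S, ∀ h ∈ S, g ≠ h → Disjoint (g • (F : Set G) ^ n) (h • (F : Set G) ^ n)) :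
    ∃ P : Finset (Set G), S.card ≤ P.card ∧
      (∀ E ∈ P, IsSide F (⋃ g ∈ S, g • (F : Set G) ^ n) E ∧ E.Infinite) ∧
      ∀ E ∈ P, ∀ E' ∈ P, ∀ x, x ∈ E → x ∈ E' → E = E' := by
  classical
  induction hN : S.card generalizing S with
  | zero => exact ⟨∅, by simp, by simp, by simp⟩
  | succ N ih =>
    obtain ⟨g, hg, a, hleaf⟩ := hD.exists_leaf hF S (Finset.card_pos.1 (by omega)) hdisj
    obtain ⟨P, hcard, hside, hPdisj⟩ := ih (S.erase g)
      (fun x hx y hy => hdisj x (Finset.mem_of_mem_erase hx) y (Finset.mem_of_mem_erase hy))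
      (by rw [Finset.card_erase_of_mem hg, hN]; rfl)
    set U' : Set G := ⋃ h ∈ S.erase g, h • (F : Set G) ^ n with hU'
    have hU : (⋃ h ∈ S, h • (F : Set G) ^ n) = g • (F : Set G) ^ n ∪ U' := by
      conv_lhs => rw [← Finset.insert_erase hg, Finset.set_biUnion_insert]
    have hcentre : g ∈ g • (F : Set G) ^ n := ⟨1, hF.one_mem_pow n, by simp⟩
    have hgU' : ∀ x ∈ g • (F : Set G) ^ n, x ∉ U' := by
      intro x hx hx'
      simp only [hU', Set.mem_iUnion] at hx'
      obtain ⟨h, hh, hxh⟩ := hx'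
      rw [Finset.mem_erase] at hh
      exact Set.disjoint_left.1 (hdisj g hg h hh.2 hh.1.symm) hx hxh
    have hU'D : ∀ x ∈ U', x ∈ g • D a := by
      intro x hx
      simp only [hU', Set.mem_iUnion] at hx
      obtain ⟨h, hh, hxh⟩ := hx
      rw [Finset.mem_erase] at hh
      exact ((hD.side a).smul g).ball_subset hF (hleaf h hh.2 hh.1) n
        (fun y hy hy' => Set.disjoint_left.1 (hdisj h hh.2 g hg hh.1) hy hy') x hxh
    have hDdisj : ∀ b c x, x ∈ g • D b → x ∈ g • D c → b = c := by
      intro b c x hb hc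
      rw [Set.mem_smul_set_iff_inv_smul_mem] at hb hc
      exact hD.eq_of_mem _ _ _ hb hc
    have hDinf : ∀ b, (g • D b).Infinite := fun b => (hD.infinite b).smul_set
    have hDU' : ∀ b, b ≠ a → ∀ x ∈ g • D b, x ∉ U' :=
      fun b hb x hx hx' => hb (hDdisj _ _ x hx (hU'D x hx'))
    have hPD : ∀ E ∈ P, g ∉ E → ∀ b, b ≠ a → ∀ x, x ∈ E → x ∉ g • D b := by
      intro E hE hgE b hb x hxE hxD
      obtain ⟨k, hk, hkE⟩ := ((hD.side b).smul g).exists_mem_inter hF (hside E hE).1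
        ⟨g, hcentre⟩ (hDU' b hb) hgU' hxD hxE
      exact hgE ((hside E hE).1.centre_mem hF n hgU' hk hkE)
    obtain ⟨b, c, hb, hc, hbc⟩ : ∃ b c : Fin 3, b ≠ a ∧ c ≠ a ∧ b ≠ c := by
      have : ∀ a : Fin 3, ∃ b c : Fin 3, b ≠ a ∧ c ≠ a ∧ b ≠ c := by decide
      exact this a
    have hsideD : ∀ d, d ≠ a → IsSide F (g • (F : Set G) ^ n ∪ U') (g • D d) := by
      intro d hd
      have h1 := (hD.side d).smul g
      exact ⟨fun x hx hx' => hx'.elim (h1.notMem x hx) (hDU' d hd x hx),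
        fun x hx s hs hxs => h1.mul_mem x hx s hs (fun h => hxs (Or.inl h))⟩
    have hmem : ∀ E, E ∈ P.filter (fun E => g ∉ E) ∪ {g • D b, g • D c} ↔
        (E ∈ P ∧ g ∉ E) ∨ ∃ d, d ≠ a ∧ (d = b ∨ d = c) ∧ E = g • D d := by
      intro E
      simp only [Finset.mem_union, Finset.mem_filter, Finset.mem_insert, Finset.mem_singleton]
      refine or_congr Iff.rfl ⟨?_, ?_⟩
      · rintro (h | h)
        · exact ⟨b, hb, Or.inl rfl, h⟩
        · exact ⟨c, hc, Or.inr rfl, h⟩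
      · rintro ⟨d, -, rfl | rfl, h⟩
        · exact Or.inl h
        · exact Or.inr h
    refine ⟨P.filter (fun E => g ∉ E) ∪ {g • D b, g • D c}, ?_, ?_, ?_⟩
    · have h1 : (P.filter (fun E => g ∈ E)).card ≤ 1 := by
        refine Finset.card_le_one.2 fun E hE E' hE' => ?_
        rw [Finset.mem_filter] at hE hE'
        exact hPdisj E hE.1 E' hE'.1 g hE.2 hE'.2
      have h2 := Finset.card_filter_add_card_filter_not (s := P) (fun E => g ∈ E)
      have h3 : (g • D b) ≠ g • D c := by
        intro h
        obtain ⟨x, hx⟩ := (hDinf b).nonempty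
        exact hbc (hDdisj b c x hx (h ▸ hx))
      rw [Finset.card_union_of_disjoint, Finset.card_pair h3]
      · have := hcard
        omega
      · rw [Finset.disjoint_left]
        intro E hE hE'
        rw [Finset.mem_filter] at hE
        have : ∃ d, d ≠ a ∧ E = g • D d := by
          rw [Finset.mem_insert, Finset.mem_singleton] at hE'
          exact hE'.elim (fun h => ⟨b, hb, h⟩) (fun h => ⟨c, hc, h⟩)
        obtain ⟨d, hd, rfl⟩ := this
        obtain ⟨x, hx⟩ := (hDinf d).nonempty
        exact hPD _ hE.1 hE.2 d hd x hx hx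
    · intro E hE
      rw [hU]
      rcases (hmem E).1 hE with ⟨hE, hgE⟩ | ⟨d, hd, -, rfl⟩
      · have h1 := (hside E hE).1
        refine ⟨⟨fun x hx hx' => hx'.elim (fun h => ?_) (h1.notMem x hx),
          fun x hx s hs hxs => h1.mul_mem x hx s hs (fun h => hxs (Or.inr h))⟩, (hside E hE).2⟩
        exact hgE (h1.centre_mem hF n hgU' h hx)
      · exact ⟨hsideD d hd, hDinf d⟩
    · intro E hE E' hE' x hx hx'
      rcases (hmem E).1 hE with ⟨hE, hgE⟩ | ⟨d, hd, -, rfl⟩ <;>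
        rcases (hmem E').1 hE' with ⟨hE', hgE'⟩ | ⟨d', hd', -, rfl⟩
      · exact hPdisj E hE E' hE' x hx hx'
      · exact absurd hx' (hPD E hE hgE d' hd' x hx)
      · exact absurd hx (hPD E' hE' hgE' d hd x hx')
      · rw [hDdisj d d' x hx hx']

end Sides

/-! ### Growth of finite sets -/

section Growth

variable {G : Type*} [Group G] {F : Finset G}

/-- Shortest paths from `A` into an infinite side of `U` reach every distance from `A` outside the
radius within which `U` lies. -/
theorem IsSide.exists_mem_level (hF : IsSymmGen F) {U E : Set G} (hE : IsSide F U E)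
    (hinf : E.Infinite) {A : Finset G} (hA : A.Nonempty) {m : ℕ}
    (hU : U ⊆ (A : Set G) * (F : Set G) ^ m) :
    ∃ y ∈ E, y ∈ (A : Set G) * (F : Set G) ^ (m + 1) ∧ y ∉ (A : Set G) * (F : Set G) ^ m := by
  classical
  have hmono : ∀ {i j : ℕ}, i ≤ j → (A : Set G) * (F : Set G) ^ i ⊆ (A : Set G) * (F : Set G) ^ j :=
    fun h => Set.mul_subset_mul_left (hF.pow_mono h)
  have hfin : ((A : Set G) * (F : Set G) ^ m).Finite := by
    have h : (((A * F ^ m : Finset G) : Set G)).Finite := Finset.finite_toSet _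
    simpa using h
  have hex : ∃ k, ∃ y ∈ E, y ∈ (A : Set G) * (F : Set G) ^ k ∧
      y ∉ (A : Set G) * (F : Set G) ^ m := by
    obtain ⟨y, hyE, hy⟩ := (hinf.sdiff hfin).nonempty
    obtain ⟨a, ha⟩ := hA
    obtain ⟨k, hk⟩ := hF.exists_mem_pow (a⁻¹ * y)
    exact ⟨k, y, hyE, ⟨a, ha, _, hk, by simp⟩, hy⟩
  obtain ⟨y, hyE, hy, hym⟩ := Nat.find_spec hex
  set k := Nat.find hex with hk
  have hmk : m < k := by
    by_contra! h
    exact hym (hmono h hy)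
  obtain ⟨j, hj⟩ : ∃ j, k = j + 1 := ⟨k - 1, by omega⟩
  rcases Nat.lt_or_ge m j with hmj | hmj
  · -- Otherwise the predecessor of `y` is still in `E`, contradicting minimality of `k`.
    exfalso
    have hyj : y ∉ (A : Set G) * (F : Set G) ^ j :=
      fun h => Nat.find_min hex (m := j) (by omega) ⟨y, hyE, h, hym⟩
    rw [hj, pow_succ, ← mul_assoc] at hy
    obtain ⟨z, hz, s, hs, rfl⟩ := hy
    have hzm : z ∉ (A : Set G) * (F : Set G) ^ m := by
      intro h
      refine hyj (hmono (show m + 1 ≤ j by omega) ?_)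
      rw [pow_succ, ← mul_assoc]
      exact Set.mul_mem_mul h hs
    have hzE : z ∈ E := by
      have := hE.mul_mem _ hyE _ (hF.inv_mem s hs)
      simp only [mul_inv_cancel_right] at this
      exact this (fun h => hzm (hU h))
    exact Nat.find_min hex (m := j) (by omega) ⟨z, hzE, hz, hzm⟩
  · have : k = m + 1 := by omega
    exact ⟨y, hyE, this ▸ hy, hym⟩

theorem IsSide.le_card_filter [DecidableEq G] (hF : IsSymmGen F) {U E : Set G}
    [DecidablePred (· ∈ E)] (hE : IsSide F U E) (hinf : E.Infinite) {A : Finset G}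
    (hA : A.Nonempty) {m : ℕ} (hU : U ⊆ (A : Set G) * (F : Set G) ^ m) (k : ℕ) :
    k ≤ ((A * F ^ (m + k)).filter (· ∈ E)).card := by
  induction k with
  | zero => exact Nat.zero_le _
  | succ k ih =>
    refine lt_of_le_of_lt ih (Finset.card_lt_card ?_)
    have hmono : ∀ {i j : ℕ}, i ≤ j →
        (A : Set G) * (F : Set G) ^ i ⊆ (A : Set G) * (F : Set G) ^ j :=
      fun h => Set.mul_subset_mul_left (hF.pow_mono h)
    have hmem : ∀ i y, y ∈ A * F ^ i ↔ y ∈ (A : Set G) * (F : Set G) ^ i := by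
      intro i y
      rw [← Finset.mem_coe]
      simp
    obtain ⟨y, hyE, hy, hyk⟩ := hE.exists_mem_level hF hinf hA (m := m + k)
      (hU.trans (hmono (Nat.le_add_right m k)))
    refine ⟨fun x hx => ?_, fun h => ?_⟩
    · rw [Finset.mem_filter, hmem] at hx ⊢
      exact ⟨hmono (by omega) hx.1, hx.2⟩
    · have := h (Finset.mem_filter.2 ⟨(hmem _ y).2 hy, hyE⟩)
      exact hyk ((hmem _ y).1 (Finset.mem_filter.1 this).1)

/-- A group with a tripod is non-amenable: some fixed thickening at least doubles the size of every
finite set. A maximal family of disjoint balls with centres in `A` has a size proportional to that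
of `A`, and each of the resulting sides contributes arbitrarily many points near `A`. -/
theorem IsTripod.exists_two_mul_card_le [DecidableEq G] (hF : IsSymmGen F) {n : ℕ}
    {D : Fin 3 → Set G} (hD : IsTripod F n D) :
    ∃ M, ∀ A : Finset G, 2 * A.card ≤ (A * F ^ M).card := by
  classical
  refine ⟨n + 2 * (F ^ (n + n)).card, fun A => ?_⟩
  rcases A.eq_empty_or_nonempty with rfl | hA
  · simp
  obtain ⟨S, hS, hmax⟩ := Finset.exists_max_image
    (A.powerset.filter fun S => ∀ g ∈ S, ∀ h ∈ S, g ≠ h →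
      Disjoint (g • (F : Set G) ^ n) (h • (F : Set G) ^ n)) Finset.card
    ⟨∅, by simp⟩
  simp only [Finset.mem_filter, Finset.mem_powerset] at hS hmax
  obtain ⟨hSA, hdisj⟩ := hS
  have hcover : A ⊆ S * F ^ (n + n) := by
    intro a ha
    by_contra hcon
    have hfar : ∀ g ∈ S, Disjoint (g • (F : Set G) ^ n) (a • (F : Set G) ^ n) := by
      intro g hg
      rw [Set.disjoint_left]
      rintro _ ⟨u, hu, rfl⟩ ⟨v, hv, huv⟩
      apply hcon
      have h1 : g⁻¹ * a ∈ F ^ (n + n) := by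
        rw [← Finset.mem_coe, Finset.coe_pow, pow_add]
        refine ⟨u, hu, v⁻¹, hF.inv_mem_pow n hv, ?_⟩
        simp only [smul_eq_mul] at huv ⊢
        rw [mul_inv_eq_iff_eq_mul, mul_assoc, huv]
        group
      exact Finset.mem_mul.2 ⟨g, hg, _, h1, by group⟩
    have haS : a ∉ S := by
      intro haS
      refine hcon (Finset.mem_mul.2 ⟨a, haS, 1, ?_, by simp⟩)
      rw [← Finset.mem_coe, Finset.coe_pow]
      exact hF.one_mem_pow _
    have := hmax (insert a S) ⟨Finset.insert_subset ha hSA, ?_⟩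
    · rw [Finset.card_insert_of_notMem haS] at this
      omega
    · intro g hg h hh hne
      rw [Finset.mem_insert] at hg hh
      rcases hg with rfl | hg <;> rcases hh with rfl | hh
      · exact absurd rfl hne
      · exact (hfar h hh).symm
      · exact hfar g hg
      · exact hdisj g hg h hh hne
  obtain ⟨P, hcard, hside, hPdisj⟩ := hD.exists_sides hF S hdisj
  have hU : (⋃ g ∈ S, g • (F : Set G) ^ n) ⊆ (A : Set G) * (F : Set G) ^ n := by
    intro x hx
    simp only [Set.mem_iUnion] at hx
    obtain ⟨g, hg, u, hu, rfl⟩ := hx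
    exact ⟨g, hSA hg, u, hu, rfl⟩
  set c := (F ^ (n + n)).card with hc
  calc 2 * A.card ≤ 2 * (S.card * c) :=
        Nat.mul_le_mul_left _ ((Finset.card_le_card hcover).trans Finset.card_mul_le)
    _ ≤ P.card * (2 * c) := by
        rw [Nat.mul_left_comm]
        exact Nat.mul_le_mul_right _ hcard
    _ = ∑ _E ∈ P, 2 * c := by rw [Finset.sum_const, smul_eq_mul]
    _ ≤ ∑ E ∈ P, ((A * F ^ (n + 2 * c)).filter (· ∈ E)).card :=
        Finset.sum_le_sum fun E hE =>
          (hside E hE).1.le_card_filter hF (hside E hE).2 hA hU (2 * c)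
    _ = (P.biUnion fun E => (A * F ^ (n + 2 * c)).filter (· ∈ E)).card := by
        rw [Finset.card_biUnion]
        intro E hE E' hE' hne
        rw [Function.onFun, Finset.disjoint_left]
        intro x hx hx'
        exact hne (hPdisj E hE E' hE' x (Finset.mem_filter.1 hx).2 (Finset.mem_filter.1 hx').2)
    _ ≤ (A * F ^ (n + 2 * c)).card :=
        Finset.card_le_card (Finset.biUnion_subset.2 fun E _ => Finset.filter_subset _ _)

/-- By Hall's marriage theorem, doubling is witnessed by two injections of `G` with disjoint ranges
that move every point by an element of a fixed finite set. -/
theorem exists_injective_of_two_mul_card_le [DecidableEq G] (T : Finset G)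
    (hT : ∀ A : Finset G, 2 * A.card ≤ (A * T).card) :
    ∃ i : G × Bool → G, Function.Injective i ∧ ∀ q, q.1⁻¹ * i q ∈ T := by
  obtain ⟨i, hi, hmem⟩ := (Finset.all_card_le_biUnion_card_iff_exists_injective
    (fun q : G × Bool => T.image (q.1 * ·))).1 (fun s => by
      calc s.card ≤ ((s.image Prod.fst) ×ˢ (Finset.univ : Finset Bool)).card :=
            Finset.card_le_card fun q hq => Finset.mem_product.2
              ⟨Finset.mem_image_of_mem _ hq, Finset.mem_univ _⟩
        _ = 2 * (s.image Prod.fst).card := by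
            rw [Finset.card_product, Finset.card_univ, Fintype.card_bool, mul_comm]
        _ ≤ _ := hT _
        _ ≤ _ := Finset.card_le_card fun x hx => by
            obtain ⟨g, hg, t, ht, rfl⟩ := Finset.mem_mul.1 hx
            obtain ⟨q, hq, rfl⟩ := Finset.mem_image.1 hg
            exact Finset.mem_biUnion.2 ⟨q, hq, Finset.mem_image_of_mem _ ht⟩)
  refine ⟨i, hi, fun q => ?_⟩
  obtain ⟨t, ht, h⟩ := Finset.mem_image.1 (hmem q)
  rw [← h]
  simpa using ht

end Growth

/-! ### From ends to tripods -/

section Ends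

open CategoryTheory Opposite

/-- The component of the complement of `K` chosen by an end. -/
def endComponent {V : Type*} (Γ : SimpleGraph V) (e : Γ.end) (K : Finset V) : Γ.ComponentCompl K :=
  e.val (op K)

variable {V : Type*} {Γ : SimpleGraph V}

theorem endComponent_hom (e : Γ.end) {K L : Finset V} (h : K ⊆ L) :
    (endComponent Γ e L).hom h = endComponent Γ e K :=
  e.prop (opHomOfLE h)

theorem endComponent_infinite (e : Γ.end) (K : Finset V) :
    (endComponent Γ e K : Set V).Infinite :=
  (endComponent Γ e K).infinite_iff_in_all_ranges.2 fun L h =>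
    ⟨endComponent Γ e L, endComponent_hom e h⟩

theorem exists_endComponent_ne {e e' : Γ.end} (h : e ≠ e') :
    ∃ K, ∀ L, K ⊆ L → endComponent Γ e L ≠ endComponent Γ e' L := by
  by_contra! hcon
  refine h (Subtype.ext (funext fun K => ?_))
  obtain ⟨L, hKL, hL⟩ := hcon K.unop
  change endComponent Γ e K.unop = endComponent Γ e' K.unop
  rw [← endComponent_hom e hKL, ← endComponent_hom e' hKL, hL]

/-- A group with infinitely many ends has a tripod: three ends are separated by some ball, which is
enlarged from the finite set separating them; the third side absorbs all components not chosen by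
the first two ends. -/
theorem HasInfinitelyManyEnds.exists_isTripod {G : Type*} [Group G]
    (hG : HasInfinitelyManyEnds G) :
    ∃ (F : Finset G) (n : ℕ) (D : Fin 3 → Set G), IsSymmGen F ∧ IsTripod F n D := by
  classical
  obtain ⟨S, hS, hinf⟩ := hG
  set Γ := SimpleGraph.mulCayley (S : Set G) with hΓ
  set F : Finset G := insert 1 (S ∪ S⁻¹) with hFdef
  have hF : IsSymmGen F := by
    refine ⟨by simp [hFdef], fun s hs => ?_, ?_⟩
    · simp only [hFdef, Finset.mem_insert, Finset.mem_union, Finset.mem_inv'] at hs ⊢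
      rcases hs with rfl | hs | hs
      · simp
      · exact Or.inr (Or.inr (by simpa using hs))
      · exact Or.inr (Or.inl hs)
    · rw [eq_top_iff, ← hS]
      exact Subgroup.closure_mono fun s hs => by simp [hFdef, Finset.mem_coe.1 hs]
  let e : Fin 3 ↪ Γ.end := Fin.valEmbedding.trans (Infinite.natEmbedding Γ.end)
  obtain ⟨K₁, h₁⟩ := exists_endComponent_ne (e.injective.ne (show (0 : Fin 3) ≠ 1 by decide))
  obtain ⟨K₂, h₂⟩ := exists_endComponent_ne (e.injective.ne (show (0 : Fin 3) ≠ 2 by decide))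
  obtain ⟨K₃, h₃⟩ := exists_endComponent_ne (e.injective.ne (show (1 : Fin 3) ≠ 2 by decide))
  obtain ⟨n, hn⟩ : ∃ n, ∀ x ∈ K₁ ∪ K₂ ∪ K₃, x ∈ F ^ n := by
    choose d hd using hF.exists_mem_pow
    refine ⟨(K₁ ∪ K₂ ∪ K₃).sup d, fun x hx => ?_⟩
    rw [← Finset.mem_coe, Finset.coe_pow]
    exact hF.pow_mono (Finset.le_sup (f := d) hx) (hd x)
  set L := F ^ n with hL
  have hLcoe : (L : Set G) = (F : Set G) ^ n := by rw [hL, Finset.coe_pow]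
  set C : Fin 3 → Γ.ComponentCompl L := fun a => endComponent Γ (e a) L with hC
  have h01 : C 0 ≠ C 1 := h₁ L fun x hx => hn x (by simp [hx])
  have h02 : C 0 ≠ C 2 := h₂ L fun x hx => hn x (by simp [hx])
  have h12 : C 1 ≠ C 2 := h₃ L fun x hx => hn x (by simp [hx])
  have hCinf : ∀ a, (C a : Set G).Infinite := fun a => endComponent_infinite _ _
  have hCside : ∀ X : Γ.ComponentCompl L, IsSide F (L : Set G) (X : Set G) := by
    refine fun X => ⟨fun x hx => X.notMem_of_mem hx, fun x hx s hs hxs => ?_⟩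
    by_cases hne : x = x * s
    · exact hne ▸ hx
    refine X.mem_of_adj x (x * s) hx hxs ?_
    rw [hΓ, SimpleGraph.mulCayley_adj]
    refine ⟨hne, ?_⟩
    simp only [hFdef, Finset.mem_insert, Finset.mem_union, Finset.mem_inv'] at hs
    rcases hs with rfl | hs | hs
    · simp at hne
    · left; simpa using hs
    · right; simpa using hs
  have hdisj : ∀ X Y : Γ.ComponentCompl L, ∀ x, x ∈ X → x ∈ Y → X = Y := by
    intro X Y x hX hY
    by_contra hne
    exact Set.disjoint_left.1 (SimpleGraph.ComponentCompl.pairwise_disjoint hne) hX hY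
  set R : Set G := {x | x ∉ (L : Set G) ∧ x ∉ C 0 ∧ x ∉ C 1} with hR
  have hRside : IsSide F (L : Set G) R := by
    refine ⟨fun x hx => hx.1, fun x hx s hs hxs => ⟨hxs, fun h => hx.2.1 ?_, fun h => hx.2.2 ?_⟩⟩
    · have := (hCside _).mul_mem _ h _ (hF.inv_mem s hs)
      rw [mul_inv_cancel_right] at this
      exact this hx.1
    · have := (hCside _).mul_mem _ h _ (hF.inv_mem s hs)
      rw [mul_inv_cancel_right] at this
      exact this hx.1
  have hRinf : R.Infinite := (hCinf 2).mono fun x hx =>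
    ⟨(C 2).notMem_of_mem hx, fun h => h02 (hdisj _ _ x h hx), fun h => h12 (hdisj _ _ x h hx)⟩
  refine ⟨F, n, ![(C 0 : Set G), (C 1 : Set G), R], hF, ?_, ?_, ?_, ?_⟩
  · rw [← hLcoe]
    intro a
    fin_cases a
    exacts [hCside _, hCside _, hRside]
  · intro a
    fin_cases a
    exacts [hCinf 0, hCinf 1, hRinf]
  · have h0 : ∀ x, x ∈ C 0 → x ∉ C 1 := fun x hx hx' => h01 (hdisj _ _ x hx hx')
    intro a b x ha hb
    fin_cases a <;> fin_cases b
    exacts [rfl, (h0 x ha hb).elim, (hb.2.1 ha).elim, (h0 x hb ha).elim, rfl, (hb.2.2 ha).elim,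
      (ha.2.1 hb).elim, (ha.2.2 hb).elim, rfl]
  · intro x hx
    rw [← hLcoe] at hx
    by_cases h0 : x ∈ C 0
    · exact ⟨0, h0⟩
    by_cases h1 : x ∈ C 1
    · exact ⟨1, h1⟩
    · exact ⟨2, hx, h0, h1⟩

end Ends

/-! ### The spectral gap in `L^p` -/

section SpectralGap

variable {G : Type*} [Group G] {p : ℝ≥0∞} [Fact (1 ≤ p)]

theorem norm_rightTranslate (hp' : p ≠ ∞) (x : G) (f : GroupLp G p) :
    ‖rightTranslate x f‖ = ‖f‖ := by
  have h0 : 0 < p.toReal := ENNReal.toReal_pos (zero_lt_one.trans_le Fact.out).ne' hp'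
  rw [lp.norm_eq_tsum_rpow h0, lp.norm_eq_tsum_rpow h0]
  congr 1
  exact (Equiv.mulRight x⁻¹).tsum_eq (fun g => ‖f g‖ ^ p.toReal)

/-- A function in `L^p` that is constant on an infinite set vanishes there. -/
theorem eq_zero_of_const_on_infinite {G : Type*} {p : ℝ≥0∞} [Fact (1 ≤ p)] (hp' : p ≠ ∞)
    (f : GroupLp G p) {D : Set G}
    (hD : D.Infinite) {c : ℝ} (hc : ∀ x ∈ D, f x = c) : c = 0 := by
  have h0 : 0 < p.toReal := ENNReal.toReal_pos (zero_lt_one.trans_le Fact.out).ne' hp'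
  by_contra hne
  have hpos : 0 < ‖c‖ ^ p.toReal := Real.rpow_pos_of_pos (norm_pos_iff.2 hne) _
  have ht := ((lp.memℓp f).summable h0).tendsto_cofinite_zero.eventually_lt_const hpos
  rw [Filter.eventually_cofinite] at ht
  exact hD (ht.subset fun x hx => by simp [hc x hx])

variable (p) in
/-- The family of differences `(f_{t⁻¹} - f)_{t ∈ T}`, as a linear map of `f ∈ L^p(G)`. -/
noncomputable def differences (T : Finset G) : GroupLp G p →ₗ[ℝ] (T → GroupLp G p) :=
  LinearMap.pi fun t => rightTranslate (t : G)⁻¹ - LinearMap.id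

theorem differences_apply (T : Finset G) (f : GroupLp G p) (t : T) :
    differences p T f t = rightTranslate (t : G)⁻¹ f - f := rfl

theorem norm_differences_le (hp' : p ≠ ∞) (T : Finset G) (f : GroupLp G p) :
    ‖differences p T f‖ ≤ 2 * ‖f‖ := by
  refine (pi_norm_le_iff_of_nonneg (by positivity)).2 fun t => ?_
  rw [differences_apply]
  refine (norm_sub_le _ _).trans ?_
  rw [norm_rightTranslate hp', two_mul]

theorem memℓp_comp_injective {G : Type*} {p : ℝ≥0∞} [Fact (1 ≤ p)] (hp' : p ≠ ∞)
    (f : GroupLp G p) {u : G → G}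
    (hu : Function.Injective u) : Memℓp (fun g => f (u g)) p := by
  have h0 : 0 < p.toReal := ENNReal.toReal_pos (zero_lt_one.trans_le Fact.out).ne' hp'
  exact memℓp_gen (((lp.memℓp f).summable h0).comp_injective hu)

/-- Moving every point by an element of `T` changes `f` by at most its differences along `T`. -/
theorem norm_comp_sub_rpow_le (hp' : p ≠ ∞) (T : Finset G) (f : GroupLp G p) {u : G → G}
    (hu : Function.Injective u) (hT : ∀ g, g⁻¹ * u g ∈ T) :
    ‖(⟨fun g => f (u g), memℓp_comp_injective hp' f hu⟩ : GroupLp G p) - f‖ ^ p.toReal ≤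
      T.card * ‖differences p T f‖ ^ p.toReal := by
  have h0 : 0 < p.toReal := ENNReal.toReal_pos (zero_lt_one.trans_le Fact.out).ne' hp'
  have hsum : ∀ t : T, Summable fun g => ‖differences p T f t g‖ ^ p.toReal :=
    fun t => (lp.memℓp _).summable h0
  rw [lp.norm_rpow_eq_tsum h0]
  calc _ ≤ ∑' g, ∑ t : T, ‖differences p T f t g‖ ^ p.toReal := by
        refine Summable.tsum_le_tsum (fun g => ?_) ((lp.memℓp _).summable h0)
          (summable_sum fun t _ => hsum t)
        refine le_trans (le_of_eq ?_) (Finset.single_le_sum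
          (f := fun t : T => ‖differences p T f t g‖ ^ p.toReal)
          (fun t _ => by positivity) (Finset.mem_univ (⟨g⁻¹ * u g, hT g⟩ : T)))
        simp only [differences_apply, lp.coeFn_sub, Pi.sub_apply, rightTranslate_apply, inv_inv,
          mul_inv_cancel_left]
    _ = ∑ t : T, ‖differences p T f t‖ ^ p.toReal := by
        rw [Summable.tsum_finsetSum fun t _ => hsum t]
        simp_rw [lp.norm_rpow_eq_tsum h0]
    _ ≤ ∑ _t : T, ‖differences p T f‖ ^ p.toReal := by
        gcongr with t
        exact norm_le_pi_norm _ t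
    _ = _ := by simp

/-- Two injections with disjoint ranges and displacements in `T` bound the norm on `L^p(G)` by the
differences along `T`: one of the two pullbacks of `f` has norm at most `2 ^ (-1/p) * ‖f‖`, while
both are close to `f`. -/
theorem exists_norm_le_differences (hp' : p ≠ ∞) (T : Finset G) {i : G × Bool → G}
    (hi : Function.Injective i) (hT : ∀ q, q.1⁻¹ * i q ∈ T) :
    ∃ C : NNReal, ∀ f : GroupLp G p, ‖f‖ ≤ C * ‖differences p T f‖ := by
  have h0 : 0 < p.toReal := ENNReal.toReal_pos (zero_lt_one.trans_le Fact.out).ne' hp'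
  set r := p.toReal with hr
  set θ : ℝ := (1 / 2) ^ (1 / r) with hθ
  have hθ1 : θ < 1 := Real.rpow_lt_one (by norm_num) (by norm_num) (by positivity)
  set d : ℝ := (T.card : ℝ) ^ (1 / r) with hd
  have hd0 : 0 ≤ d := by positivity
  have hroot : ∀ {a b c : ℝ}, 0 ≤ a → 0 ≤ b → 0 ≤ c → a ^ r ≤ c * b ^ r → a ≤ c ^ (1 / r) * b := by
    intro a b c ha hb hc h
    refine (Real.rpow_le_rpow_iff ha (by positivity) h0).1 (h.trans (le_of_eq ?_))
    rw [Real.mul_rpow (by positivity) hb, ← Real.rpow_mul hc, one_div_mul_cancel h0.ne',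
      Real.rpow_one]
  refine ⟨⟨d / (1 - θ), div_nonneg hd0 (sub_nonneg.2 hθ1.le)⟩, fun f => ?_⟩
  have hinj : ∀ b, Function.Injective fun g => i (g, b) :=
    fun b g g' h => (Prod.ext_iff.1 (hi h)).1
  set u : Bool → GroupLp G p :=
    fun b => ⟨fun g => f (i (g, b)), memℓp_comp_injective hp' f (hinj b)⟩ with hu
  have hclose : ∀ b, ‖u b - f‖ ≤ d * ‖differences p T f‖ := fun b =>
    hroot (norm_nonneg _) (norm_nonneg _) (Nat.cast_nonneg _)
      (norm_comp_sub_rpow_le hp' T f (hinj b) fun g => hT (g, b))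
  have hsum : ‖u false‖ ^ r + ‖u true‖ ^ r ≤ ‖f‖ ^ r := by
    have hf := (lp.memℓp f).summable h0
    have hinj' : Function.Injective fun q : Bool × G => i q.swap := hi.comp Prod.swap_injective
    have h1 : Summable fun q : Bool × G => ‖f (i q.swap)‖ ^ r := hf.comp_injective hinj'
    have h2 := h1.tsum_prod
    rw [tsum_bool] at h2
    rw [lp.norm_rpow_eq_tsum h0 f, lp.norm_rpow_eq_tsum h0 (u false),
      lp.norm_rpow_eq_tsum h0 (u true)]
    calc _ = ∑' q : Bool × G, ‖f (i q.swap)‖ ^ r := h2.symm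
      _ ≤ _ := tsum_comp_le_tsum_of_inj hf (fun g => by positivity) hinj'
  obtain ⟨b, hb⟩ : ∃ b, ‖u b‖ ^ r ≤ 1 / 2 * ‖f‖ ^ r := by
    by_contra! hcon
    have h1 := hcon false
    have h2 := hcon true
    linarith
  have hsmall := hroot (norm_nonneg _) (norm_nonneg _) (by norm_num) hb
  have htri : ‖f‖ ≤ ‖u b‖ + ‖u b - f‖ := norm_le_norm_add_norm_sub _ _
  have hc := hclose b
  change ‖f‖ ≤ d / (1 - θ) * ‖differences p T f‖
  rw [div_mul_eq_mul_div, le_div_iff₀ (by linarith)]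
  linarith

/-- A bound of the norm by the differences makes the range of `differences` closed. -/
theorem isClosed_range_differences (hp' : p ≠ ∞) {T : Finset G} {C : NNReal}
    (hC : ∀ f : GroupLp G p, ‖f‖ ≤ C * ‖differences p T f‖) :
    IsClosed (Set.range (differences p T)) :=
  (AddMonoidHomClass.antilipschitz_of_bound (differences p T) hC).isClosed_range
    (AddMonoidHomClass.uniformContinuous_of_bound (differences p T) 2
      (norm_differences_le hp' T))

end SpectralGap

/-! ### The cocycle of a side -/

section Cocycle

variable {G : Type*} [Group G] {p : ℝ≥0∞} [Fact (1 ≤ p)]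

/-- The cocycle `x ↦ f_x - f` of a function `f`, not necessarily in `L^p(G)`, all of whose
differences `f_x - f` lie in `L^p(G)`. -/
def cocycleOfFunction (f : G → ℝ) (hf : ∀ x : G, Memℓp (fun g => f (g * x⁻¹) - f g) p) :
    oneCocycles G p :=
  ⟨fun x => ⟨fun g => f (g * x⁻¹) - f g, hf x⟩, by
    rw [LinearMap.mem_ker]
    funext z
    ext g
    change (f (g * z.2⁻¹ * z.1⁻¹) - f (g * z.2⁻¹)) - (f (g * (z.1 * z.2)⁻¹) - f g) +
      (f (g * z.2⁻¹) - f g) = 0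
    rw [mul_inv_rev, ← mul_assoc]
    ring⟩

theorem cocycleOfFunction_apply (f : G → ℝ)
    (hf : ∀ x : G, Memℓp (fun g => f (g * x⁻¹) - f g) p) (x g : G) :
    (cocycleOfFunction f hf : G → GroupLp G p) x g = f (g * x⁻¹) - f g := rfl

/-- The indicator function of a side of a finite set is almost invariant under right
translations. -/
theorem IsSide.finite_indicator_ne {F : Finset G} (hF : IsSymmGen F) {U E : Set G}
    (hE : IsSide F U E) (hU : U.Finite) (x : G) :
    {g | E.indicator (1 : G → ℝ) (g * x⁻¹) - E.indicator (1 : G → ℝ) g ≠ 0}.Finite := by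
  refine hF.mem_of_mul_mem (x := 1) (X := {x | {g | E.indicator (1 : G → ℝ) (g * x⁻¹) -
    E.indicator (1 : G → ℝ) g ≠ 0}.Finite}) (by simp) ?_ x
  intro y hy s hs
  have h1 := hy.preimage (f := fun g => g * s⁻¹) (mul_left_injective s⁻¹).injOn
  have h2 := hU.preimage (f := fun g => g * s⁻¹) (mul_left_injective s⁻¹).injOn
  refine ((h1.union h2).union hU).subset fun g hg => ?_
  by_contra hcon
  simp only [Set.mem_union, Set.mem_preimage, Set.mem_ofPred_eq, not_or, not_not] at hcon
  obtain ⟨⟨hy', hgs⟩, hg'⟩ := hcon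
  apply hg
  -- Neither `g` nor `g s⁻¹` lies in `U`, so they are on the same side.
  have hiff : g * s⁻¹ ∈ E ↔ g ∈ E := by
    refine ⟨fun h => ?_, fun h => hE.mul_mem g h _ (hF.inv_mem s hs) hgs⟩
    have := hE.mul_mem _ h s hs
    rw [inv_mul_cancel_right] at this
    exact this hg'
  have hind : E.indicator (1 : G → ℝ) (g * s⁻¹) = E.indicator (1 : G → ℝ) g := by
    classical
    simp only [Set.indicator_apply, hiff, Pi.one_apply]
  rw [mul_inv_rev, ← mul_assoc, ← hind]
  exact hy'

theorem memℓp_of_finite_ne_zero {G : Type*} {p : ℝ≥0∞} {f : G → ℝ}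
    (hf : {g | f g ≠ 0}.Finite) : Memℓp f p :=
  (memℓp_zero hf).of_exponent_ge (zero_le)

/-- If the range of the differences along a generating set `T` is closed, then a cocycle
`x ↦ f_x - f` in the closure of the coboundaries comes from a function of `L^p(G)`, which differs
from `f` by a constant. -/
theorem exists_sub_eq_const_of_mem_closure {F T : Finset G} (hF : IsSymmGen F) (hFT : F ⊆ T)
    (hT : IsClosed (Set.range (differences p T))) (f : G → ℝ)
    (hf : ∀ x : G, Memℓp (fun g => f (g * x⁻¹) - f g) p)
    (hmem : cocycleOfFunction f hf ∈ (oneCoboundaries G p).topologicalClosure) :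
    ∃ (h : GroupLp G p) (c : ℝ), ∀ x, f x - h x = c := by
  set φ : oneCocycles G p → (T → GroupLp G p) := fun b t => (b : G → GroupLp G p) (t : G)⁻¹ with hφ
  have hφc : Continuous φ :=
    continuous_pi fun t => (continuous_apply (t : G)⁻¹).comp continuous_subtype_val
  have hmaps : Set.MapsTo φ (oneCoboundaries G p) (Set.range (differences p T)) := by
    rintro b ⟨h, hh⟩
    refine ⟨h, ?_⟩
    funext t
    exact congrFun hh (t : G)⁻¹
  have h1 : φ (cocycleOfFunction f hf) ∈ Set.range (differences p T) := by
    have := hmaps.closure hφc hmem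
    rwa [hT.closure_eq] at this
  obtain ⟨h, hh⟩ := h1
  refine ⟨h, f 1 - h 1, hF.mem_of_mul_mem (X := {x | f x - h x = f 1 - h 1}) (x := 1) rfl ?_⟩
  intro y hy s hs
  have h2 := congrArg (fun v : T → GroupLp G p => v ⟨s, hFT hs⟩ y) hh
  simp only [differences_apply, lp.coeFn_sub, Pi.sub_apply, rightTranslate_apply, inv_inv, hφ,
    cocycleOfFunction_apply] at h2
  simp only [Set.mem_ofPred_eq] at hy ⊢
  linarith

end Cocycle

/-! ### Nonvanishing of the reduced cohomology -/

theorem mainTheorem6 (G : Type*) [Group G] [Group.FG G] (hG : HasInfinitelyManyEnds G)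
    (p : ℝ≥0∞) [Fact (1 ≤ p)] (hp : 1 < p) (hp' : p ≠ ∞) :
    Nontrivial (ReducedLpCohomologyOne G p) := by
  classical
  obtain ⟨F, n, D, hF, hD⟩ := hG.exists_isTripod
  obtain ⟨M, hM⟩ := hD.exists_two_mul_card_le hF
  -- The exponent is raised by one to make sure that the ball contains `F`.
  have hmono : ∀ {i j : ℕ}, i ≤ j → F ^ i ⊆ F ^ j := by
    intro i j h
    rw [← Finset.coe_subset, Finset.coe_pow, Finset.coe_pow]
    exact hF.pow_mono h
  have hFT : F ⊆ F ^ (M + 1) := by simpa using hmono (show 1 ≤ M + 1 by omega)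
  obtain ⟨i, hi, hiT⟩ := exists_injective_of_two_mul_card_le (F ^ (M + 1)) fun A =>
    (hM A).trans (Finset.card_le_card (Finset.mul_subset_mul_left (hmono M.le_succ)))
  obtain ⟨C, hC⟩ := exists_norm_le_differences (p := p) hp' _ hi hiT
  have hfin : ((F : Set G) ^ n).Finite := by
    rw [← Finset.coe_pow]
    exact Finset.finite_toSet _
  rw [Submodule.Quotient.nontrivial_iff]
  intro htop
  obtain ⟨h, c, hc⟩ := exists_sub_eq_const_of_mem_closure hF hFT
    (isClosed_range_differences hp' hC) ((D 0).indicator 1)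
    (fun x => memℓp_of_finite_ne_zero ((hD.side 0).finite_indicator_ne hF hfin x))
    (by rw [htop]; trivial)
  -- `h` equals `1 - c` on one infinite side and `-c` on another.
  have h0 : 1 - c = 0 := eq_zero_of_const_on_infinite hp' h (hD.infinite 0) fun x hx => by
    have := hc x
    rw [Set.indicator_of_mem hx, Pi.one_apply] at this
    linarith
  have h1 : -c = 0 := eq_zero_of_const_on_infinite hp' h (hD.infinite 1) fun x hx => by
    have := hc x
    rw [Set.indicator_of_notMem (fun hx' => absurd (hD.eq_of_mem 0 1 x hx' hx) (by decide))] at this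
    linarith
  linarith
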